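/- Let $n\ge r\ge 3$ and $t\ge 3$ be integers. A hypergraph $H=(V(H),E(H))$ is an $r$-graph if every edge is a set of exactly $r$ vertices; it is linear if any two distinct edges share at most one vertex. For a simple graph $F$, a hypergraph $B$ is a Berge-$F$ if, after identifying the vertices of $F$ with distinct vertices of $B$, there is a bijection $\phi:E(F)\to E(B)$ with $e\subseteq\phi(e)$ for all $e\in E(F)$; and $H$ is Berge-$F$-free if no subhypergraph of $H$ is a Berge-$F$. For an $r$-graph $H$ with $n$ vertices, let $\mathcal A(H)$ be its adjacency tensor of order $r$, indexed by $V(H)$, with entry $\mathcal A_{i_1\cdots i_r}=\frac1{(r-1)!}$ if $\{i_1,\dots,i_r\}\in E(H)$ and $0$ otherwise. A number $\lambda\in\mathbb C$ is an eigenvalue of $\mathcal A(H)$ if there is a nonzero vector $x\in\mathbb C^{V(H)}$ with $$\sum_{i_2,\dots,i_r\in V(H)}\mathcal A_{i\,i_2\cdots i_r}x_{i_2}\cdots x_{i_r}=\lambda x_i^{r-1}\qquad\text{for all } i\in V(H),$$ and the spectral radius $\rho(H)$ is the maximum of $|\lambda|$ over all eigenvalues $\lambda$ of $\mathcal A(H)$.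 Put $$f(n,r,t,x,y)=\Big(t(r-1)+\frac{(r-2)(n-r)}{2(r-1)}+\frac{n-r}{(r-1)^2}\Big)x+\frac{1}{r-1}\,y-\Big(t+r-2+\frac{(r-2)(n-r-2)}{2(r-1)}-\frac{(r-2)(r-3)(n-r)}{2(r-1)^2}\Big).$$ Theorem. Every connected Berge-$K_{3,t}$-free linear $r$-graph $H$ with $n$ vertices satisfies $$\rho(H)\le f\Big(n,r,t,\frac{n-1}{r-1},\frac{n-1}{r-1}\Big)^{1/2}.$$ -/

import Mathlib

open scoped Hypergraph

namespace Hypergraph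

variable {α : Type*}

/-- `H` is an `r`-graph: every edge has exactly `r` vertices. -/
def IsUniform (H : Hypergraph α) (r : ℕ) : Prop :=
  ∀ e ∈ E(H), e.Finite ∧ e.ncard = r

/-- `H` is linear: two distinct edges share at most one vertex. -/
def IsLinear (H : Hypergraph α) : Prop :=
  ∀ e ∈ E(H), ∀ f ∈ E(H), e ≠ f → (e ∩ f).Subsingleton

/-- `H` is connected: it has a vertex, and any two vertices are joined by a finite sequence of
vertices in which consecutive ones lie in a common edge. -/
def IsConnected (H : Hypergraph α) : Prop :=
  V(H).Nonempty ∧ ∀ u ∈ V(H), ∀ v ∈ V(H), Relation.ReflTransGen H.Adj u v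

/-- `B` is a Berge-`F`: after placing the vertices of `F` injectively among those of `B`, there is a
bijection `φ : E(F) → E(B)` with `e ⊆ φ e` for every edge `e` of `F`. -/
def IsBerge {W : Type*} (F : SimpleGraph W) (B : Hypergraph α) : Prop :=
  ∃ ι : W ↪ α, Set.range ι ⊆ V(B) ∧
    ∃ φ : F.edgeSet ≃ E(B), ∀ e : F.edgeSet, ∀ w ∈ (e : Sym2 W), ι w ∈ (φ e : Set α)

/-- `B` is a subhypergraph of `H`. -/
def IsSubhypergraph (B H : Hypergraph α) : Prop :=
  V(B) ⊆ V(H) ∧ E(B) ⊆ E(H)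

/-- `H` is Berge-`F`-free: no subhypergraph of `H` is a Berge-`F`. -/
def BergeFree {W : Type*} (F : SimpleGraph W) (H : Hypergraph α) : Prop :=
  ∀ B : Hypergraph α, B.IsSubhypergraph H → ¬ B.IsBerge F

end Hypergraph

/-- A complex tensor (hypermatrix) of order `r` whose indices range over `ι`. -/
abbrev CTensor (ι : Type*) (r : ℕ) : Type _ := (Fin r → ι) → ℂ

namespace CTensor

variable {ι : Type*} [Fintype ι] {r : ℕ}

open Classical in
/-- The vector `T x^{r-1}`: its `i`-th entry is the sum of `T (i, i₂, …, i_r) x_{i₂} ⋯ x_{i_r}`,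
that is, the sum over the index tuples whose first entry is `i`. -/
noncomputable def apply (T : CTensor ι r) (x : ι → ℂ) (i : ι) : ℂ :=
  ∑ j : Fin r → ι with ∀ k : Fin r, (k : ℕ) = 0 → j k = i,
    T j * ∏ k ∈ Finset.univ.filter (fun k : Fin r => (k : ℕ) ≠ 0), x (j k)

/-- `z` is an eigenvalue of `T`: `T x^{r-1} = z x^{[r-1]}` for some nonzero vector `x`. -/
def IsEigenvalue (T : CTensor ι r) (z : ℂ) : Prop :=
  ∃ x : ι → ℂ, x ≠ 0 ∧ ∀ i, T.apply x i = z * x i ^ (r - 1)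

/-- The spectral radius of `T`: the largest modulus of an eigenvalue. The supremum is a maximum
whenever there is an eigenvalue, see `isGreatest_spectralRadius`. -/
noncomputable def spectralRadius (T : CTensor ι r) : ℝ :=
  sSup {s : ℝ | ∃ z : ℂ, T.IsEigenvalue z ∧ s = ‖z‖}

lemma card_pos_index (r : ℕ) : (Finset.univ.filter fun k : Fin r => (k : ℕ) ≠ 0).card = r - 1 := by
  cases r with
  | zero => rfl
  | succ m =>
    have h : (Finset.univ.filter fun k : Fin (m + 1) => (k : ℕ) ≠ 0) = Finset.univ.erase 0 := by
      ext k
      simp only [Finset.mem_filter, Finset.mem_univ, true_and, Finset.mem_erase, and_true, ne_eq,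
        Fin.ext_iff, Fin.val_zero]
    rw [h, Finset.card_erase_of_mem (Finset.mem_univ _)]
    simp

lemma apply_smul (T : CTensor ι r) (c : ℂ) (x : ι → ℂ) (i : ι) :
    T.apply (c • x) i = c ^ (r - 1) * T.apply x i := by
  classical
  unfold apply
  rw [Finset.mul_sum]
  refine Finset.sum_congr rfl fun j _ => ?_
  have h : ∏ k ∈ Finset.univ.filter (fun k : Fin r => (k : ℕ) ≠ 0), (c • x) (j k)
      = c ^ (r - 1) * ∏ k ∈ Finset.univ.filter (fun k : Fin r => (k : ℕ) ≠ 0), x (j k) := by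
    rw [← card_pos_index r, ← Finset.prod_const, ← Finset.prod_mul_distrib]
    rfl
  rw [h]
  ring

lemma continuous_tensor_apply (T : CTensor ι r) (i : ι) : Continuous fun x : ι → ℂ => T.apply x i := by
  unfold apply
  exact continuous_finsetSum _ fun j _ =>
    continuous_const.mul (continuous_finsetProd _ fun k _ => continuous_apply (j k))

lemma norm_apply_le (T : CTensor ι r) (x : ι → ℂ) (hx : ‖x‖ = 1) (i : ι) :
    ‖T.apply x i‖ ≤ ∑ j : Fin r → ι, ‖T j‖ := by
  classical
  unfold apply
  refine (norm_sum_le _ _).trans ((Finset.sum_le_sum fun j _ => ?_).trans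
    (Finset.sum_le_sum_of_subset_of_nonneg (Finset.filter_subset _ _) fun _ _ _ => norm_nonneg _))
  rw [norm_mul, norm_prod]
  refine mul_le_of_le_one_right (norm_nonneg _) (Finset.prod_le_one (fun _ _ => norm_nonneg _) ?_)
  exact fun k _ => hx ▸ norm_le_pi_norm x (j k)

/-- If `T` has an eigenvalue, its spectral radius is attained as a maximum. -/
lemma isGreatest_spectralRadius (T : CTensor ι r) (hT : ∃ z, T.IsEigenvalue z) :
    IsGreatest {s : ℝ | ∃ z : ℂ, T.IsEigenvalue z ∧ s = ‖z‖} T.spectralRadius := by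
  set C : ℝ := ∑ j : Fin r → ι, ‖T j‖ with hC
  let S : Set (ℂ × (ι → ℂ)) := {p | ‖p.2‖ = 1 ∧ ∀ i, T.apply p.2 i = p.1 * p.2 i ^ (r - 1)}
  have hSbd : S ⊆ Metric.closedBall 0 C ×ˢ Metric.closedBall 0 1 := by
    rintro ⟨z, x⟩ ⟨hx, hz⟩
    simp only at hx hz
    refine ⟨?_, by simp [hx]⟩
    have hne : Nonempty ι := by
      by_contra hι
      rw [not_nonempty_iff] at hι
      simp [Subsingleton.elim x 0] at hx
    obtain ⟨i, hi⟩ : ∃ i, ‖x i‖ = 1 := by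
      obtain ⟨i, -, hi⟩ := Finset.exists_max_image Finset.univ (fun i => ‖x i‖)
        Finset.univ_nonempty
      refine ⟨i, le_antisymm (hx ▸ norm_le_pi_norm x i) ?_⟩
      rw [← hx]
      exact (pi_norm_le_iff_of_nonneg (norm_nonneg _)).2 fun k => hi k (Finset.mem_univ _)
    have h := norm_apply_le T x hx i
    rw [hz i, norm_mul, norm_pow, hi, one_pow, mul_one] at h
    simpa using h
  have hScl : IsClosed S := by
    have h1 : IsClosed {p : ℂ × (ι → ℂ) | ‖p.2‖ = 1} :=
      isClosed_eq (by fun_prop) continuous_const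
    have h2 : IsClosed {p : ℂ × (ι → ℂ) | ∀ i, T.apply p.2 i = p.1 * p.2 i ^ (r - 1)} := by
      rw [Set.ofPred_forall]
      exact isClosed_iInter fun i =>
        isClosed_eq ((T.continuous_tensor_apply i).comp continuous_snd) (by fun_prop)
    exact h1.inter h2
  have hScp : IsCompact S :=
    ((isCompact_closedBall _ _).prod (isCompact_closedBall _ _)).of_isClosed_subset hScl hSbd
  have himg : {s : ℝ | ∃ z : ℂ, T.IsEigenvalue z ∧ s = ‖z‖} = (fun p => ‖p.1‖) '' S := by
    ext s
    constructor
    · rintro ⟨z, ⟨x, hx, hz⟩, rfl⟩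
      have hn : ‖x‖ ≠ 0 := norm_ne_zero_iff.2 hx
      refine ⟨(z, ((‖x‖⁻¹ : ℝ) : ℂ) • x), ⟨?_, fun i => ?_⟩, rfl⟩
      · simp only [norm_smul, Complex.norm_real, norm_inv, norm_norm]
        exact inv_mul_cancel₀ hn
      · simp only [apply_smul, hz i, Pi.smul_apply, smul_eq_mul, mul_pow]
        ring
    · rintro ⟨⟨z, x⟩, ⟨hx, hz⟩, rfl⟩
      refine ⟨z, ⟨x, ?_, hz⟩, rfl⟩
      rintro rfl
      simp at hx
  have hcp : IsCompact {s : ℝ | ∃ z : ℂ, T.IsEigenvalue z ∧ s = ‖z‖} := by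
    rw [himg]
    exact hScp.image (by fun_prop)
  obtain ⟨z, hz⟩ := hT
  exact hcp.isGreatest_sSup ⟨‖z‖, z, hz, rfl⟩

end CTensor

namespace Hypergraph

variable {α : Type*}

open Classical in
/-- The adjacency tensor of order `r` of a hypergraph `H`: its indices are the vertices of `H`, and
the entry at `(i₁, …, i_r)` is `1 / (r-1)!` if `{i₁, …, i_r}` is an edge of `H`, and `0` otherwise. -/
noncomputable def adjTensor (H : Hypergraph α) (r : ℕ) : CTensor V(H) r :=
  fun j => if Set.range (fun k => (j k : α)) ∈ E(H) then 1 / ((r - 1).factorial : ℂ) else 0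

/-- The spectral radius of an `r`-graph: that of its adjacency tensor of order `r`. -/
noncomputable def spectralRadius (H : Hypergraph α) [Fintype V(H)] (r : ℕ) : ℝ :=
  (H.adjTensor r).spectralRadius

/-- For `r ≥ 3`, the adjacency tensor of an `r`-graph with a vertex has an eigenvalue, so that its
spectral radius is a maximum over a nonempty set. -/
lemma exists_isEigenvalue_adjTensor (H : Hypergraph α) [Fintype V(H)] {r : ℕ} (hr : 3 ≤ r)
    (hH : H.IsUniform r) (hV : V(H).Nonempty) : ∃ z, (H.adjTensor r).IsEigenvalue z := by
  classical
  obtain ⟨v, hv⟩ := hV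
  refine ⟨0, Pi.single ⟨v, hv⟩ 1, by simp, fun i => ?_⟩
  rw [zero_mul, CTensor.apply]
  refine Finset.sum_eq_zero fun j _ => ?_
  by_cases h1 : j ⟨1, by omega⟩ = ⟨v, hv⟩
  · by_cases h2 : j ⟨2, by omega⟩ = ⟨v, hv⟩
    · refine mul_eq_zero_of_left (if_neg fun he => ?_) _
      have hc := (hH _ he).2
      have hinj : Function.Injective fun k => (j k : α) := by
        have hc' : (Finset.univ.image fun k => (j k : α)).card =
            (Finset.univ : Finset (Fin r)).card := by
          rw [Finset.card_univ, Fintype.card_fin, ← Set.ncard_coe_finset]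
          simpa using hc
        simpa using Finset.card_image_iff.1 hc'
      have h := @hinj ⟨1, by omega⟩ ⟨2, by omega⟩ (by simp [h1, h2])
      simp at h
    · exact mul_eq_zero_of_right _
        (Finset.prod_eq_zero (i := (⟨2, by omega⟩ : Fin r)) (by simp) (by simp [h2]))
  · exact mul_eq_zero_of_right _
        (Finset.prod_eq_zero (i := (⟨1, by omega⟩ : Fin r)) (by simp) (by simp [h1]))

end Hypergraph

/-- The function `f(n, r, t, x, y)`. -/
noncomputable def bergeBound (n r t x y : ℝ) : ℝ :=
  (t * (r - 1) + (r - 2) * (n - r) / (2 * (r - 1)) + (n - r) / (r - 1) ^ 2) * x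
    + 1 / (r - 1) * y
    - (t + r - 2 + (r - 2) * (n - r - 2) / (2 * (r - 1))
        - (r - 2) * (r - 3) * (n - r) / (2 * (r - 1) ^ 2))

/-!
The bound holds because it dominates the square of the largest degree that a linear `r`-graph on
`n` vertices can have.

Let `z` be an eigenvalue with eigenvector `x`, and let `i` be a vertex at which `‖x i‖` is largest.
The eigenvalue equation at `i` gives `‖z‖ ≤ N / (r - 1)!`, where `N` is the number of orderings
`(i, i₂, …, i_r)` of edges through `i` (`CTensor.IsEigenvalue.exists_norm_le_sum`). Sorting these
orderings by `v = i₂ ≠ i`, linearity says that at most one edge contains both `i` and `v`, and it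
leaves at most `(r - 2)!` orderings of the other vertices. Hence `N ≤ (n - 1) (r - 2)!`, and
`‖z‖ ≤ (n - 1) / (r - 1) =: D` (`Hypergraph.IsLinear.spectralRadius_le`).

With `n - 1 = (r - 1) D`, the difference `f(n, r, t, D, D) - D²` is a quadratic polynomial in `D - 1`
whose coefficients are nonnegative for `r ≥ 3` and `t ≥ 3` (`sq_le_bergeBound`).
-/

/-! ### Eigenvalues and slice sums of a tensor -/

open Classical in
/-- The modulus of an eigenvalue is at most the largest `ℓ¹`-norm of a slice of the tensor: compare
the two sides of the eigenvalue equation at a coordinate of largest modulus. -/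
lemma CTensor.IsEigenvalue.exists_norm_le_sum {ι : Type*} [Fintype ι] {r : ℕ} {T : CTensor ι r}
    {z : ℂ} (hz : T.IsEigenvalue z) :
    ∃ i, ‖z‖ ≤ ∑ j : Fin r → ι with ∀ k : Fin r, (k : ℕ) = 0 → j k = i, ‖T j‖ := by
  obtain ⟨x, hx, hxz⟩ := hz
  obtain ⟨i₀, hi₀⟩ := Function.ne_iff.1 hx
  obtain ⟨i, -, hi⟩ := Finset.exists_max_image Finset.univ (fun i => ‖x i‖) ⟨i₀, Finset.mem_univ _⟩
  have hpos : 0 < ‖x i‖ := (norm_pos_iff.2 hi₀).trans_le (hi i₀ (Finset.mem_univ _))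
  refine ⟨i, le_of_mul_le_mul_right ?_ (pow_pos hpos (r - 1))⟩
  rw [← norm_pow, ← norm_mul, ← hxz i, CTensor.apply, Finset.sum_mul]
  refine (norm_sum_le _ _).trans (Finset.sum_le_sum fun j _ => ?_)
  rw [norm_mul, norm_prod, norm_pow]
  refine mul_le_mul_of_nonneg_left ?_ (norm_nonneg _)
  rw [← CTensor.card_pos_index r, ← Finset.prod_const]
  exact Finset.prod_le_prod (fun _ _ => norm_nonneg _) fun k _ => hi _ (Finset.mem_univ _)

/-! ### Orderings of the edges of a linear hypergraph -/

namespace Hypergraph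

variable {α : Type*} {H : Hypergraph α}

/-- An ordering of an edge of an `r`-graph by `r` indices has no repetition. -/
lemma IsUniform.injective_of_range_mem {r : ℕ} (hH : H.IsUniform r) {j : Fin r → V(H)}
    (hj : Set.range (fun k => (j k : α)) ∈ E(H)) : Function.Injective j := by
  classical
  have hc : (Finset.univ.image fun k => (j k : α)).card = (Finset.univ : Finset (Fin r)).card := by
    rw [Finset.card_univ, Fintype.card_fin, ← Set.ncard_coe_finset]
    simpa using (hH _ hj).2
  have hinj : Function.Injective fun k => (j k : α) := by simpa using Finset.card_image_iff.1 hc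
  exact hinj.of_comp

open Classical in
/-- At most one edge of a linear `(s + 2)`-graph contains two given vertices, so it has at most `s!`
orderings starting with them. -/
lemma IsLinear.card_orderings_le_factorial [Fintype V(H)] {s : ℕ} (hlin : H.IsLinear)
    (hH : H.IsUniform (s + 2)) (i v : V(H)) :
    (Finset.univ.filter fun j : Fin (s + 2) → V(H) =>
      Set.range (fun k => (j k : α)) ∈ E(H) ∧ j 0 = i ∧ j 1 = v).card ≤ s.factorial := by
  set A := Finset.univ.filter fun j : Fin (s + 2) → V(H) =>
    Set.range (fun k => (j k : α)) ∈ E(H) ∧ j 0 = i ∧ j 1 = v with hA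
  obtain hA0 | ⟨j₀, hj₀⟩ := A.eq_empty_or_nonempty
  · simp [hA0]
  simp only [hA, Finset.mem_filter, Finset.mem_univ, true_and] at hj₀
  obtain ⟨he₀, h0, h1⟩ := hj₀
  have hinj₀ := hH.injective_of_range_mem he₀
  have hiv : (i : α) ≠ v := by
    rw [← h0, ← h1]
    exact fun h => by simpa using hinj₀ (Subtype.ext h)
  have hrange : ∀ j ∈ A, Set.range (fun k => (j k : α)) = Set.range fun k => (j₀ k : α) := by
    intro j hj
    simp only [hA, Finset.mem_filter, Finset.mem_univ, true_and] at hj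
    by_contra hne
    exact hiv (hlin _ hj.1 _ he₀ hne ⟨⟨0, by simp [hj.2.1]⟩, ⟨0, by simp [h0]⟩⟩
      ⟨⟨1, by simp [hj.2.2]⟩, ⟨1, by simp [h1]⟩⟩)
  -- The entries of `j` after the first two enumerate the same set for every `j`.
  let S : Finset V(H) := Finset.univ.image fun k : Fin s => j₀ k.succ.succ
  have hS : S.card ≤ s := Finset.card_image_le.trans (by simp)
  have hmem : ∀ j ∈ A, ∀ k : Fin s, j k.succ.succ ∈ S := by
    intro j hj k
    have hinj : Function.Injective j := by
      simp only [hA, Finset.mem_filter, Finset.mem_univ, true_and] at hj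
      exact hH.injective_of_range_mem hj.1
    obtain ⟨l, hl⟩ : (j k.succ.succ : α) ∈ Set.range fun k => (j₀ k : α) := by
      rw [← hrange j hj]
      exact ⟨_, rfl⟩
    replace hl : j₀ l = j k.succ.succ := Subtype.ext hl
    simp only [hA, Finset.mem_filter, Finset.mem_univ, true_and] at hj
    induction l using Fin.cases with
    | zero =>
      rw [h0, ← hj.2.1] at hl
      exact absurd (hinj hl).symm (Fin.succ_ne_zero _)
    | succ l =>
      induction l using Fin.cases with
      | zero =>
        rw [Fin.succ_zero_eq_one, h1, ← hj.2.2, ← Fin.succ_zero_eq_one] at hl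
        exact absurd (Fin.succ_injective _ (hinj hl)).symm (Fin.succ_ne_zero _)
      | succ l => exact Finset.mem_image.2 ⟨l, Finset.mem_univ _, hl⟩
  let F : A → (Fin s ↪ S) := fun j =>
    ⟨fun k => ⟨(j : Fin (s + 2) → V(H)) k.succ.succ, hmem j j.2 k⟩, fun k l hkl => by
      have hj := j.2
      simp only [hA, Finset.mem_filter, Finset.mem_univ, true_and] at hj
      simpa using hH.injective_of_range_mem hj.1 (congrArg Subtype.val hkl)⟩
  have hF : Function.Injective F := by
    rintro ⟨j, hj⟩ ⟨l, hl⟩ h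
    have htail : ∀ k : Fin s, j k.succ.succ = l k.succ.succ := fun k =>
      congrArg Subtype.val (DFunLike.congr_fun h k)
    simp only [hA, Finset.mem_filter, Finset.mem_univ, true_and] at hj hl
    refine Subtype.ext (funext fun k => ?_)
    induction k using Fin.cases with
    | zero => exact hj.2.1.trans hl.2.1.symm
    | succ k =>
      induction k using Fin.cases with
      | zero => exact hj.2.2.trans hl.2.2.symm
      | succ k => exact htail k
  have hcard := Fintype.card_le_of_injective F hF
  rw [Fintype.card_embedding_eq, Fintype.card_coe, Fintype.card_coe, Fintype.card_fin] at hcard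
  exact hcard.trans ((Nat.descFactorial_le s hS).trans (Nat.descFactorial_self s).le)

open Classical in
/-- This is `(r - 1)!` times the degree bound `(n - 1) / (r - 1)` for a vertex `i` of a linear
`r`-graph, with `r = s + 2`. -/
lemma IsLinear.card_orderings_le [Fintype V(H)] {s : ℕ} (hlin : H.IsLinear)
    (hH : H.IsUniform (s + 2)) (i : V(H)) :
    (Finset.univ.filter fun j : Fin (s + 2) → V(H) =>
      Set.range (fun k => (j k : α)) ∈ E(H) ∧ j 0 = i).card ≤
      (Fintype.card V(H) - 1) * s.factorial := by
  rw [← Finset.card_univ, ← Finset.card_erase_of_mem (Finset.mem_univ i), mul_comm]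
  refine Finset.card_le_mul_card_image_of_maps_to (f := fun j => j 1) (fun j hj => ?_) _
    fun v _ => ?_
  · simp only [Finset.mem_filter, Finset.mem_univ, true_and] at hj
    refine Finset.mem_erase.2 ⟨?_, Finset.mem_univ _⟩
    rw [← hj.2]
    exact fun h => by simpa using hH.injective_of_range_mem hj.1 h
  · simpa only [Finset.filter_filter, and_assoc] using hlin.card_orderings_le_factorial hH i v

/-! ### The spectral radius of a linear hypergraph -/

/-- The right-hand side is the largest degree that a vertex of a linear `r`-graph can have. -/
theorem IsLinear.spectralRadius_le [Fintype V(H)] {r : ℕ} (hr : 2 ≤ r) (hlin : H.IsLinear)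
    (hH : H.IsUniform r) (hV : V(H).Nonempty) :
    H.spectralRadius r ≤ ((Fintype.card V(H) : ℝ) - 1) / ((r : ℝ) - 1) := by
  classical
  obtain ⟨s, rfl⟩ := Nat.exists_eq_add_of_le' hr
  have hn : 1 ≤ Fintype.card V(H) := Fintype.card_pos_iff.2 hV.to_subtype
  have hs : (0 : ℝ) < s + 1 := by positivity
  have hden : ((s + 2 : ℕ) : ℝ) - 1 = s + 1 := by
    push_cast
    ring
  have hnum : ((Fintype.card V(H) - 1 : ℕ) : ℝ) = (Fintype.card V(H) : ℝ) - 1 := by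
    push_cast [hn]
    ring
  rw [hden, ← hnum]
  refine Real.sSup_le ?_ (by positivity)
  rintro _ ⟨z, hz, rfl⟩
  obtain ⟨i, hi⟩ := hz.exists_norm_le_sum
  refine hi.trans ?_
  have hfilter : ∀ j : Fin (s + 2) → V(H),
      (∀ k : Fin (s + 2), (k : ℕ) = 0 → j k = i) ↔ j 0 = i := by
    refine fun j => ⟨fun h => h 0 rfl, fun h k hk => ?_⟩
    rwa [show k = 0 from Fin.ext hk]
  have hnorm : ∀ j : Fin (s + 2) → V(H), ‖H.adjTensor (s + 2) j‖ =
      if Set.range (fun k => (j k : α)) ∈ E(H) then 1 / ((s + 1).factorial : ℝ) else 0 := by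
    intro j
    rw [adjTensor]
    split_ifs <;> simp
  simp only [hfilter, hnorm]
  rw [← Finset.sum_filter, Finset.sum_const,
    Finset.filter_filter, nsmul_eq_mul, mul_one_div, div_le_div_iff₀ (by positivity) hs,
    Nat.factorial_succ]
  have hcard := hlin.card_orderings_le hH i
  simp only [and_comm] at hcard ⊢
  have hcast : ((Finset.univ.filter fun j : Fin (s + 2) → V(H) =>
      j 0 = i ∧ Set.range (fun k => (j k : α)) ∈ E(H)).card : ℝ) ≤
      ((Fintype.card V(H) - 1 : ℕ) : ℝ) * (s.factorial : ℝ) := by exact_mod_cast hcard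
  calc _ ≤ ((Fintype.card V(H) - 1 : ℕ) : ℝ) * (s.factorial : ℝ) * (s + 1) :=
        mul_le_mul_of_nonneg_right hcast hs.le
    _ = _ := by
        push_cast
        ring

end Hypergraph

/-! ### Comparison with the bound -/

lemma sq_le_bergeBound {n r t : ℝ} (hr : 3 ≤ r) (hn : r ≤ n) (ht : 3 ≤ t) :
    ((n - 1) / (r - 1)) ^ 2 ≤ bergeBound n r t ((n - 1) / (r - 1)) ((n - 1) / (r - 1)) := by
  obtain ⟨m, rfl⟩ : ∃ m, r = m + 1 := ⟨r - 1, by ring⟩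
  have hm : 2 ≤ m := by linarith
  have hm0 : m ≠ 0 := by positivity
  obtain ⟨d, rfl⟩ : ∃ d, n = m * (d + 1) + 1 := ⟨(n - 1) / m - 1, by
    field_simp
    ring⟩
  have hd : 0 ≤ d := by
    by_contra! h
    nlinarith
  have key : bergeBound (m * (d + 1) + 1) (m + 1) t (d + 1) (d + 1) - (d + 1) ^ 2 =
      (m - 1) * (m - 2) / (2 * m) * d ^ 2
        + (t * m - (m - 1) / 2 - (m - 1) / m + (m - 1) * (m - 2) / m) * d
        + (m - 1) * (t - 3 / 2 + 1 / m + (m - 2) / (2 * m)) := by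
    unfold bergeBound
    rw [add_sub_cancel_right]
    field_simp
    ring
  have hx : (m * (d + 1) + 1 - 1) / (m + 1 - 1) = d + 1 := by
    rw [add_sub_cancel_right, add_sub_cancel_right, mul_div_cancel_left₀ _ hm0]
  have h2 : 0 ≤ m - 2 := by linarith
  have h1 : 0 ≤ m - 1 := by linarith
  have hlin : 0 ≤ t * m - (m - 1) / 2 - (m - 1) / m := by
    have : (m - 1) / m ≤ 1 := (div_le_one (by linarith)).2 (by linarith)
    nlinarith
  have hcon : 0 ≤ t - 3 / 2 := by linarith
  rw [hx, ← sub_nonneg, key]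
  positivity

theorem theorem1p2 {α : Type*} (n r t : ℕ) (hr : 3 ≤ r) (hn : r ≤ n) (ht : 3 ≤ t)
    (H : Hypergraph α) [Fintype V(H)] (hcard : Fintype.card V(H) = n)
    (hunif : H.IsUniform r) (hlin : H.IsLinear) (hconn : H.IsConnected)
    (hfree : H.BergeFree (completeBipartiteGraph (Fin 3) (Fin t))) :
    H.spectralRadius r ≤
      √(bergeBound n r t (((n : ℝ) - 1) / ((r : ℝ) - 1)) (((n : ℝ) - 1) / ((r : ℝ) - 1))) := by
  subst hcard
  exact (hlin.spectralRadius_le (by omega) hunif hconn.1).trans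
    (Real.le_sqrt_of_sq_le (sq_le_bergeBound (by exact_mod_cast hr) (by exact_mod_cast hn)
      (by exact_mod_cast ht)))
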